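/- Let $A\subset\mathbb{R}^2$ be an equilateral triangle with side length $1$ and vertices $v_1,v_2,v_3$, and let $F_j$ be the side of $A$ opposite to $v_j$. For each agent $i\in\{1,2,3\}$ let $A_{i1},A_{i2},A_{i3}$ be closed sets with $A_{i1}\cup A_{i2}\cup A_{i3}=A$. The sets $A_{ij}$ are unknown to us; a query in binary mode consists of choosing $i,j\in\{1,2,3\}$ and a point $x\in A$ and being told whether $x\in A_{ij}$. For $\varepsilon>0$ put $A_{ij}^{\varepsilon}=\{x\in\mathbb{R}^2:\operatorname{dist}(x,A_{ij})\le\varepsilon\}$; a point $x\in A$ is an $\varepsilon$-fair division point if there is a permutation $\sigma$ of $\{1,2,3\}$ with $x\in A^{\varepsilon}_{i\sigma(i)}$ for all $i$. Theorem. Let $\varepsilon>0$ and $n=\lceil 1/\varepsilon\rceil$. There is a deterministic adaptive query algorithm (a decision tree, depending only on $A$ and $\varepsilon$) that makes at most $$6\bigl(\lceil\log_2 n\rceil^2+\lceil\log_2 n\rceil\bigr)$$ queries in binary mode and that, for all closed sets $A_{ij}$ as above such that every $A_{ij}$ is convex and contains $F_j$, returns an $\varepsilon$-fair division point. In particular,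 the number of queries is $O(\log^2 n)$ as $n\to\infty$. -/

import Mathlib

/-- The points `v 0, …, v (d - 1)` are at pairwise distance `1`. For `d` points of `ℝ^(d-1)` this
says that they are the vertices of a `(d - 1)`-dimensional regular simplex with edges of
length `1`. -/
def IsUnitRegularSimplex {d : ℕ} {E : Type*} [NormedAddCommGroup E] (v : Fin d → E) : Prop :=
  ∀ i j : Fin d, i ≠ j → dist (v i) (v j) = 1

/-- The simplex `A` with vertices `v`: the space of all divisions. -/
def divisionSimplex {d : ℕ} {E : Type*} [NormedAddCommGroup E] [NormedSpace ℝ E]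
    (v : Fin d → E) : Set E :=
  convexHull ℝ (Set.range v)

/-- The facet `F_j` of the simplex, opposite to the vertex `v j`. -/
def facet {d : ℕ} {E : Type*} [NormedAddCommGroup E] [NormedSpace ℝ E]
    (v : Fin d → E) (j : Fin d) : Set E :=
  convexHull ℝ (v '' {k | k ≠ j})

/-- `S i j` is the set of divisions for which agent `i` is satisfied with room `j`. For each agent
these are `d` closed sets that cover the simplex (and lie in it). -/
structure IsPreferenceProfile {d : ℕ} {E : Type*} [NormedAddCommGroup E] [NormedSpace ℝ E]
    (v : Fin d → E) (S : Fin d → Fin d → Set E) : Prop where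
  isClosed : ∀ i j, IsClosed (S i j)
  iUnion_eq : ∀ i, ⋃ j, S i j = divisionSimplex v

/-- `x` is an `ε`-fair division point. `Metric.cthickening ε T` is the set of all points whose
distance to `T` is at most `ε` (it is empty if `T` is empty). -/
def IsFairDivisionPoint {d : ℕ} {E : Type*} [NormedAddCommGroup E] [NormedSpace ℝ E]
    (v : Fin d → E) (S : Fin d → Fin d → Set E) (ε : ℝ) (x : E) : Prop :=
  x ∈ divisionSimplex v ∧
    ∃ σ : Equiv.Perm (Fin d), ∀ j, x ∈ Metric.cthickening ε (S j (σ j))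

/-- A deterministic adaptive algorithm in binary mode, as a decision tree. It either stops and
returns a point of `K`, or asks agent `i` whether the point `x` of `K` belongs to the `j`-th
preference set of `i`, and continues according to the answer. -/
inductive BinaryAlgorithm (d : ℕ) {E : Type*} (K : Set E) where
  | output (x : K)
  | query (i j : Fin d) (x : K) (onYes onNo : BinaryAlgorithm d K)

namespace BinaryAlgorithm

/-- The largest number of queries on a path from the start to an output. -/
def maxQueries {d : ℕ} {E : Type*} {K : Set E} : BinaryAlgorithm d K → ℕ
  | output _ => 0
  | query _ _ _ onYes onNo => max onYes.maxQueries onNo.maxQueries + 1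

open Classical in
/-- The point returned when the queries are answered according to the sets `S i j`. -/
noncomputable def run {d : ℕ} {E : Type*} {K : Set E} (S : Fin d → Fin d → Set E) :
    BinaryAlgorithm d K → K
  | output x => x
  | query i j x onYes onNo => if (x : E) ∈ S i j then onYes.run S else onNo.run S

end BinaryAlgorithm

/-!
The algorithm finds for each agent `i` a point `p i` within `ε` of all three sets `S i j`. Then the
closed `ε`-thickening of `S i j` is convex and contains both `p i` and the facet `F_j`, hence the
triangle `T_j (p i)` that they span. So it is enough to be fair for the three known covers
`T_j (p i)` of the simplex, and no more queries are needed.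

*A fair point for triangles.* In barycentric coordinates `x ∈ T_j (p)` says that the ratio
`x j / p j` is the least of the ratios `x k / p k`. Taking logarithms, agents with valuations
`log (p i j)` face prices `log (x j)`, and a fair point is a competitive equilibrium: the assignment
maximizes `∏ i, p i (σ i)` and the prices are an optimal dual solution, given by longest paths
(`exists_prices_of_diagonal_optimal`). Vanishing coordinates are reached by compactness
(`exists_envyFree`).

*An approximate centre for one agent.* Put coordinates `(s, t)` on the triangle such that the
squared distance is `(Δs) ^ 2 + 3 / 4 * (Δt) ^ 2`, with `t = 1` at the vertex `v 2`. By convexity,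
on a horizontal line the first set is an interval at the left end and the second one an interval at
the right end. Two bisections find where they end. Either the two intervals nearly meet (a high
line), or there is a gap between them that belongs to the third set (a low line);
see `IsConvexCover.line_dichotomy`. The base is low and the apex is high, so `L` such tests, where
`1 / 2 ^ L ≤ ε`, find a low line and a high line at vertical offset `h = 1 / 2 ^ L`. If the meeting
point on the high line lies over the gap, it is close to all three sets. If it lies to the left of
the gap, then the left end of the gap is: the second set contains everything between the meeting
point and its own side, and passes within `h` above that end
(`Convex.exists_mem_of_right_side`, `IsConvexCover.nearCentre_spec`). The other case is symmetric.
A test takes `2 * (L + 1)` queries, which gives `3 * L * 2 * (L + 1) = 6 * (L ^ 2 + L)` in all.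
-/

/-! ### Composing decision trees -/

section Trees

variable {d : ℕ} {E : Type*} {K : Set E} {α β γ : Type*}

/-- A decision tree of binary queries at points of `K` whose leaves carry a value in an arbitrary
type: the partial computations out of which a `BinaryAlgorithm` is composed. -/
inductive QueryTree (d : ℕ) {E : Type*} (K : Set E) (α : Type*) where
  | output (a : α)
  | query (i j : Fin d) (x : K) (onYes onNo : QueryTree d K α)

namespace QueryTree

/-- The largest number of queries on a path from the root to a leaf. -/
def depth : QueryTree d K α → ℕ
  | output _ => 0
  | query _ _ _ onYes onNo => max onYes.depth onNo.depth + 1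

open Classical in
/-- The value at the leaf reached when the queries are answered according to `S`. -/
noncomputable def run (S : Fin d → Fin d → Set E) : QueryTree d K α → α
  | output a => a
  | query i j x onYes onNo => if (x : E) ∈ S i j then onYes.run S else onNo.run S

/-- Run a tree and continue with a tree that depends on the value obtained. -/
def bind (T : QueryTree d K α) (f : α → QueryTree d K β) : QueryTree d K β :=
  match T with
  | output a => f a
  | query i j x onYes onNo => query i j x (onYes.bind f) (onNo.bind f)

theorem depth_bind_le {T : QueryTree d K α} {f : α → QueryTree d K β} {m : ℕ}
    (hf : ∀ a, (f a).depth ≤ m) : (T.bind f).depth ≤ T.depth + m := by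
  induction T with
  | output a => simpa [bind, depth] using hf a
  | query i j x y n hy hn => simp only [bind, depth]; omega

theorem run_bind (S : Fin d → Fin d → Set E) (T : QueryTree d K α) (f : α → QueryTree d K β) :
    (T.bind f).run S = (f (T.run S)).run S := by
  induction T with
  | output a => rfl
  | query i j x y n hy hn => simp only [bind, run]; split_ifs <;> assumption

/-- The algorithm that returns the point of `K` assigned by `f` to the value at the leaf. -/
def toBinaryAlgorithm (f : α → K) : QueryTree d K α → BinaryAlgorithm d K
  | output a => .output (f a)
  | query i j x onYes onNo =>
      .query i j x (onYes.toBinaryAlgorithm f) (onNo.toBinaryAlgorithm f)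

theorem maxQueries_toBinaryAlgorithm (f : α → K) (T : QueryTree d K α) :
    (T.toBinaryAlgorithm f).maxQueries = T.depth := by
  induction T with
  | output a => rfl
  | query i j x y n hy hn => simp [toBinaryAlgorithm, BinaryAlgorithm.maxQueries, depth, hy, hn]

theorem run_toBinaryAlgorithm (S : Fin d → Fin d → Set E) (f : α → K) (T : QueryTree d K α) :
    (T.toBinaryAlgorithm f).run S = f (T.run S) := by
  induction T with
  | output a => rfl
  | query i j x y n hy hn =>
    simp only [toBinaryAlgorithm, BinaryAlgorithm.run, run, hy, hn]; split_ifs <;> rfl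

end QueryTree

/-- With at most `n` queries at points of `K` one can find a value that stands in the relation `P`
to the hidden sets `S`, whenever these satisfy the promise `V`. -/
def Learnable (K : Set E) (V : (Fin d → Fin d → Set E) → Prop) (n : ℕ)
    (P : (Fin d → Fin d → Set E) → α → Prop) : Prop :=
  ∃ T : QueryTree d K α, T.depth ≤ n ∧ ∀ S, V S → P S (T.run S)

namespace Learnable

variable {V : (Fin d → Fin d → Set E) → Prop} {m n : ℕ}

theorem pure {P : (Fin d → Fin d → Set E) → α → Prop} (a : α) (h : ∀ S, V S → P S a) :
    Learnable K V n P :=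
  ⟨.output a, Nat.zero_le _, h⟩

theorem bind {P : (Fin d → Fin d → Set E) → α → Prop} {Q : (Fin d → Fin d → Set E) → β → Prop}
    (hP : Learnable K V m P) (hQ : ∀ a, Learnable K V n fun S b => P S a → Q S b) :
    Learnable K V (m + n) Q := by
  obtain ⟨T, hT, hTP⟩ := hP
  choose f hf hfQ using hQ
  refine ⟨T.bind f, (QueryTree.depth_bind_le hf).trans (by omega), fun S hS => ?_⟩
  rw [QueryTree.run_bind]
  exact hfQ _ S hS (hTP S hS)

theorem mono {P Q : (Fin d → Fin d → Set E) → α → Prop} (hP : Learnable K V n P)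
    (h : ∀ S, V S → ∀ a, P S a → Q S a) : Learnable K V n Q := by
  obtain ⟨T, hT, hTP⟩ := hP
  exact ⟨T, hT, fun S hS => h S hS _ (hTP S hS)⟩

theorem map {P : (Fin d → Fin d → Set E) → α → Prop} {Q : (Fin d → Fin d → Set E) → β → Prop}
    (f : α → β) (hP : Learnable K V n P) (h : ∀ S, V S → ∀ a, P S a → Q S (f a)) :
    Learnable K V n Q :=
  bind hP fun a => pure (n := 0) (f a) fun S hS => h S hS a

theorem query (i j : Fin d) {x : E} (hx : x ∈ K) :
    Learnable K V 1 fun S (b : Bool) => b = true ↔ x ∈ S i j := by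
  refine ⟨.query i j ⟨x, hx⟩ (.output true) (.output false), by simp [QueryTree.depth],
    fun S _ => ?_⟩
  by_cases h : x ∈ S i j <;> simp [QueryTree.run, h]

/-- Bisection: if `c` queries suffice to find for each index in the range a witness that it is low
or a witness that it is high, then `c * s` queries suffice to find two consecutive indices, one low
and one high, in a range of length `2 ^ s` whose ends are known to be low and high. -/
theorem bisection {Lo : (Fin d → Fin d → Set E) → ℕ → α → Prop}
    {Hi : (Fin d → Fin d → Set E) → ℕ → β → Prop} {c : ℕ} (s k₀ : ℕ)
    (test : ∀ k, k₀ < k → k < k₀ + 2 ^ s →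
      Learnable K V c fun S (r : α ⊕ β) => Sum.elim (Lo S k) (Hi S k) r) (a : α) (b : β) :
    Learnable K V (c * s) fun S (r : ℕ × α × β) => Lo S k₀ a → Hi S (k₀ + 2 ^ s) b →
      r.1 < k₀ + 2 ^ s ∧ Lo S r.1 r.2.1 ∧ Hi S (r.1 + 1) r.2.2 := by
  induction s generalizing k₀ a b with
  | zero => exact pure (k₀, a, b) fun S _ ha hb => ⟨by simp, ha, by simpa using hb⟩
  | succ s ih =>
    have hpos : 0 < 2 ^ s := by positivity
    have hdouble : k₀ + 2 ^ (s + 1) = k₀ + 2 ^ s + 2 ^ s := by ring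
    rw [hdouble] at test ⊢
    have hcost : c * (s + 1) = c + c * s := by ring
    rw [hcost]
    refine bind (test (k₀ + 2 ^ s) (by omega) (by omega)) ?_
    rintro (a' | b')
    · refine mono (ih (k₀ + 2 ^ s) (fun k h₁ h₂ => test k (by omega) (by omega)) a' b) ?_
      exact fun S _ r hr ha' _ hb => hr ha' hb
    · refine mono (ih k₀ (fun k h₁ h₂ => test k (by omega) (by omega)) a b') ?_
      intro S _ r hr hb' ha _
      obtain ⟨h₁, h₂⟩ := hr ha hb'
      exact ⟨by omega, h₂⟩

end Learnable

end Trees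

/-! ### Locating an approximate centre of one convex cover of the triangle -/

/-- The model triangle in the `(s, t)`-plane, with vertices `(1/2, 0)`, `(-1/2, 0)` and `(0, 1)`. -/
def modelTriangle : Set (ℝ × ℝ) := {x | 0 ≤ x.2 ∧ |x.1| ≤ (1 - x.2) / 2}

/-- A cover of the model triangle by three convex sets, the `j`-th of which contains the side
opposite to the `j`-th vertex, in the order `(1/2, 0)`, `(-1/2, 0)`, `(0, 1)`. By convexity it is
enough to record the end points of that side. -/
structure IsConvexCover (B : Fin 3 → Set (ℝ × ℝ)) : Prop where
  convex : ∀ j, Convex ℝ (B j)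
  subset : ∀ j, B j ⊆ modelTriangle
  cover : ∀ x ∈ modelTriangle, ∃ j, x ∈ B j
  left_mem : (-1 / 2, 0) ∈ B 0 ∧ (0, 1) ∈ B 0
  right_mem : (1 / 2, 0) ∈ B 1 ∧ (0, 1) ∈ B 1
  base_mem : (-1 / 2, 0) ∈ B 2 ∧ (1 / 2, 0) ∈ B 2

theorem Convex.mem_of_fst_between {B : Set (ℝ × ℝ)} (hB : Convex ℝ B) {a b c t : ℝ}
    (ha : (a, t) ∈ B) (hc : (c, t) ∈ B) (hab : a ≤ b) (hbc : b ≤ c) : (b, t) ∈ B := by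
  have hconv : Convex ℝ ((fun s : ℝ => (s, t)) ⁻¹' B) := by
    intro x hx y hy p q hp hq hpq
    have := hB hx hy hp hq hpq
    simp only [Prod.smul_mk, Prod.mk_add_mk, ← add_smul, hpq, one_smul] at this
    exact this
  exact hconv.ordConnected.out ha hc ⟨hab, hbc⟩

theorem Convex.mem_of_snd_between {B : Set (ℝ × ℝ)} (hB : Convex ℝ B) {s a b c : ℝ}
    (ha : (s, a) ∈ B) (hc : (s, c) ∈ B) (hab : a ≤ b) (hbc : b ≤ c) : (s, b) ∈ B := by
  have hconv : Convex ℝ ((fun t : ℝ => (s, t)) ⁻¹' B) := by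
    intro x hx y hy p q hp hq hpq
    have := hB hx hy hp hq hpq
    simp only [Prod.smul_mk, Prod.mk_add_mk, ← add_smul, hpq, one_smul] at this
    exact this
  exact hconv.ordConnected.out ha hc ⟨hab, hbc⟩

/-- A convex set that contains the right side of the model triangle and a point `(u, t')` reaches
every vertical line to the right of `u` at a height between `t` and `t'`, as long as the line
meets the triangle at height `t`. -/
theorem Convex.exists_mem_of_right_side {B : Set (ℝ × ℝ)} (hB : Convex ℝ B)
    (h₁ : (1 / 2, 0) ∈ B) (h₂ : (0, 1) ∈ B) {u s t t' : ℝ} (hu : (u, t') ∈ B)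
    (ht : 0 ≤ t) (htt' : t ≤ t') (hut' : |u| ≤ (1 - t') / 2) (hus : u ≤ s)
    (hs : s ≤ (1 - t) / 2) : ∃ τ, t ≤ τ ∧ τ ≤ t' ∧ (s, τ) ∈ B := by
  obtain ⟨hu₁, hu₂⟩ := abs_le.1 hut'
  rcases le_or_gt s u with hsu | hsu
  · obtain rfl : s = u := le_antisymm hsu hus
    exact ⟨t', htt', le_rfl, hu⟩
  have hu' : 0 < 1 / 2 - u := by linarith
  -- `(1 - l) * t'` is the height at which the segment from `(u, t')` to the vertex `(1/2, 0)`
  -- meets the vertical line through `s`.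
  set l : ℝ := (s - u) / (1 / 2 - u) with hl
  have hlu : l * (1 / 2 - u) = s - u := div_mul_cancel₀ _ hu'.ne'
  have hl₀ : 0 ≤ l := div_nonneg (by linarith) hu'.le
  have hl₁ : l ≤ 1 := (div_le_one hu').2 (by linarith)
  have hτ : (s, (1 - l) * t') ∈ B := by
    have := hB hu h₁ (sub_nonneg.2 hl₁) hl₀ (by ring)
    convert this using 1
    ext <;> simp; linarith
  have hle : (1 - l) * t' ≤ t' := by nlinarith
  -- Above it, the set contains a point of that line: on the right side of the triangle if `0 ≤ s`,
  -- and on the segment from `(u, t')` to the apex otherwise.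
  obtain ⟨τ₂, hτ₂, hmax⟩ : ∃ τ₂, (s, τ₂) ∈ B ∧ max t ((1 - l) * t') ≤ τ₂ := by
    rcases le_or_gt 0 s with hs₀ | hs₀
    · refine ⟨1 - 2 * s, ?_, max_le (by linarith) (by nlinarith)⟩
      have := hB h₁ h₂ (a := 2 * s) (b := 1 - 2 * s) (by linarith) (by linarith) (by ring)
      convert this using 1
      ext <;> simp
      ring
    · have hu'' : 0 < -u := by linarith
      set m : ℝ := (s - u) / -u with hm
      have hmu : m * -u = s - u := div_mul_cancel₀ _ hu''.ne'
      have hm₀ : 0 ≤ m := div_nonneg (by linarith) hu''.le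
      have hm₁ : m ≤ 1 := (div_le_one hu'').2 (by linarith)
      refine ⟨(1 - m) * t' + m, ?_, max_le (by nlinarith) (by nlinarith)⟩
      have := hB hu h₂ (sub_nonneg.2 hm₁) hm₀ (by ring)
      convert this using 1
      ext <;> simp
      linarith
  exact ⟨_, le_max_left _ _, max_le htt' hle, hB.mem_of_snd_between hτ hτ₂ (le_max_right _ _) hmax⟩

/-- The mirror image of `Convex.exists_mem_of_right_side`. -/
theorem Convex.exists_mem_of_left_side {B : Set (ℝ × ℝ)} (hB : Convex ℝ B)
    (h₁ : (-1 / 2, 0) ∈ B) (h₂ : (0, 1) ∈ B) {u s t t' : ℝ} (hu : (u, t') ∈ B)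
    (ht : 0 ≤ t) (htt' : t ≤ t') (hut' : |u| ≤ (1 - t') / 2) (hsu : s ≤ u)
    (hs : -((1 - t) / 2) ≤ s) : ∃ τ, t ≤ τ ∧ τ ≤ t' ∧ (s, τ) ∈ B := by
  have hconv : Convex ℝ ((fun x : ℝ × ℝ => (-x.1, x.2)) ⁻¹' B) := by
    intro x hx y hy p q hp hq hpq
    have := hB hx hy hp hq hpq
    simp only [Set.mem_preimage]
    convert this using 1
    ext <;> simp
    ring
  obtain ⟨τ, h, h', hτ⟩ := hconv.exists_mem_of_right_side (u := -u) (s := -s) (t := t) (t' := t')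
    (by simpa [neg_div] using h₁) (by simpa using h₂) (by simpa using hu) ht htt'
    (by simpa using hut') (by linarith) (by linarith)
  exact ⟨τ, h, h', by simpa using hτ⟩

/-- On the line at height `t` the third set separates the first from the second: it contains the
interval `[r.1, r.2]`, and the other two come within `h / 2` of its left and right end. -/
def IsLowLine (B : Fin 3 → Set (ℝ × ℝ)) (h t : ℝ) (r : ℝ × ℝ) : Prop :=
  r.1 ≤ r.2 ∧ (r.1, t) ∈ B 2 ∧ (r.2, t) ∈ B 2 ∧
    (∃ a, r.1 - h / 2 ≤ a ∧ a ≤ r.1 ∧ (a, t) ∈ B 0) ∧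
    ∃ b, r.2 ≤ b ∧ b ≤ r.2 + h / 2 ∧ (b, t) ∈ B 1

/-- On the line at height `t` the first and the second set come within `h / 2` of each other, at
the points with first coordinates `r.1` and `r.2`. -/
def IsHighLine (B : Fin 3 → Set (ℝ × ℝ)) (h t : ℝ) (r : ℝ × ℝ) : Prop :=
  r.1 ≤ r.2 ∧ r.2 ≤ r.1 + h / 2 ∧ (r.1, t) ∈ B 0 ∧ (r.2, t) ∈ B 1

/-- The point close to all three sets of a cover that is read off from a low line with data `r` at
height `t` and a high line with data `q` at height `t + h`. -/
noncomputable def nearCentre (h t : ℝ) (r q : ℝ × ℝ) : ℝ × ℝ :=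
  if q.2 < r.1 then (r.1, t) else if r.2 < q.1 then (r.2, t) else (q.1, t + h)

namespace IsConvexCover

variable {B : Fin 3 → Set (ℝ × ℝ)}

theorem left_end_mem (hB : IsConvexCover B) {t : ℝ} (ht₀ : 0 ≤ t) (ht₁ : t ≤ 1) :
    (-((1 - t) / 2), t) ∈ B 0 := by
  have := hB.convex 0 hB.left_mem.1 hB.left_mem.2 (sub_nonneg.2 ht₁) ht₀ (by ring)
  convert this using 1
  ext <;> simp
  ring

theorem right_end_mem (hB : IsConvexCover B) {t : ℝ} (ht₀ : 0 ≤ t) (ht₁ : t ≤ 1) :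
    ((1 - t) / 2, t) ∈ B 1 := by
  have := hB.convex 1 hB.right_mem.1 hB.right_mem.2 (sub_nonneg.2 ht₁) ht₀ (by ring)
  convert this using 1
  ext <;> simp
  ring

theorem isLowLine_zero (hB : IsConvexCover B) {h : ℝ} (hh : 0 ≤ h) :
    IsLowLine B h 0 (-1 / 2, 1 / 2) :=
  ⟨by norm_num, hB.base_mem.1, hB.base_mem.2, ⟨_, by linarith, le_rfl, hB.left_mem.1⟩,
    ⟨_, le_rfl, by linarith, hB.right_mem.1⟩⟩

theorem isHighLine_one (hB : IsConvexCover B) {h : ℝ} (hh : 0 ≤ h) :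
    IsHighLine B h 1 (0, 0) :=
  ⟨le_rfl, by dsimp only; linarith, hB.left_mem.2, hB.right_mem.2⟩

/-- The squared Euclidean distance of the model triangle is `(Δs) ^ 2 + 3 / 4 * (Δt) ^ 2`, so a
horizontal step of `h / 2` combined with a vertical step of `h` has length `h`. -/
theorem nearCentre_spec (hB : IsConvexCover B) {h t : ℝ} {r q : ℝ × ℝ} (hh : 0 ≤ h)
    (hr : IsLowLine B h t r) (hq : IsHighLine B h (t + h) q) :
    nearCentre h t r q ∈ modelTriangle ∧ ∀ j, ∃ y ∈ B j,
      ((nearCentre h t r q).1 - y.1) ^ 2 + 3 / 4 * ((nearCentre h t r q).2 - y.2) ^ 2 ≤ h ^ 2 := by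
  obtain ⟨hr₁₂, hr₁, hr₂, ⟨a, ha, har, haB⟩, b, hbr, hb, hbB⟩ := hr
  obtain ⟨hq₁₂, hqh, hq₁, hq₂⟩ := hq
  obtain ⟨ht, hr₁'⟩ := hB.subset _ hr₁
  obtain ⟨-, hr₂'⟩ := hB.subset _ hr₂
  have hq₁' := (hB.subset _ hq₁).2
  have hq₂' := (hB.subset _ hq₂).2
  dsimp only at ht hr₁' hr₂' hq₁' hq₂'
  have hth : t ≤ t + h := by linarith
  unfold nearCentre
  split_ifs with h₁ h₂
  · refine ⟨⟨ht, hr₁'⟩, Fin.forall_fin_succ.2 ⟨⟨_, haB, ?_⟩, Fin.forall_fin_two.2 ⟨?_, _, hr₁, ?_⟩⟩⟩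
    · dsimp only; nlinarith
    · obtain ⟨τ, hτ, hτ', hmem⟩ := (hB.convex 1).exists_mem_of_right_side hB.right_mem.1
        hB.right_mem.2 hq₂ ht hth hq₂' h₁.le (abs_le.1 hr₁').2
      exact ⟨_, hmem, by dsimp only; nlinarith⟩
    · dsimp only; nlinarith
  · refine ⟨⟨ht, hr₂'⟩, Fin.forall_fin_succ.2 ⟨?_, Fin.forall_fin_two.2 ⟨⟨_, hbB, ?_⟩, _, hr₂, ?_⟩⟩⟩
    · obtain ⟨τ, hτ, hτ', hmem⟩ := (hB.convex 0).exists_mem_of_left_side hB.left_mem.1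
        hB.left_mem.2 hq₁ ht hth hq₁' h₂.le (abs_le.1 hr₂').1
      exact ⟨_, hmem, by dsimp only; nlinarith⟩
    · dsimp only; nlinarith
    · dsimp only; nlinarith
  · refine ⟨⟨by simp only; linarith, hq₁'⟩,
      Fin.forall_fin_succ.2 ⟨⟨_, hq₁, ?_⟩, Fin.forall_fin_two.2 ⟨⟨_, hq₂, ?_⟩, ?_⟩⟩⟩
    · dsimp only; nlinarith
    · dsimp only; nlinarith
    · push Not at h₁ h₂
      refine ⟨(max r.1 q.1, t), (hB.convex 2).mem_of_fst_between hr₁ hr₂ (le_max_left _ _)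
        (max_le hr₁₂ h₂), ?_⟩
      dsimp only
      rcases max_cases r.1 q.1 with ⟨h', h''⟩ | ⟨h', h''⟩ <;> rw [h'] <;> nlinarith

end IsConvexCover

/-- The `k`-th point of the line at height `t`, divided into `M` equal parts from left to right. -/
noncomputable def gridPoint (t : ℝ) (M k : ℕ) : ℝ := (k / M - 1 / 2) * (1 - t)

theorem gridPoint_mem {t : ℝ} (ht₀ : 0 ≤ t) (ht₁ : t ≤ 1) {M k : ℕ} (hk : k ≤ M) :
    (gridPoint t M k, t) ∈ modelTriangle := by
  have h₀ : (0 : ℝ) ≤ k / M := by positivity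
  have h₁ : (k : ℝ) / M ≤ 1 := div_le_one_of_le₀ (by exact_mod_cast hk) (by positivity)
  refine ⟨ht₀, abs_le.2 ?_⟩
  simp only [gridPoint]
  constructor <;> nlinarith

theorem gridPoint_mono {t : ℝ} (ht₁ : t ≤ 1) (M : ℕ) : Monotone (gridPoint t M) := by
  intro k l hkl
  unfold gridPoint
  gcongr

theorem gridPoint_zero (t : ℝ) (M : ℕ) : gridPoint t M 0 = -((1 - t) / 2) := by
  simp [gridPoint]; ring

theorem gridPoint_self (t : ℝ) {M : ℕ} (hM : M ≠ 0) : gridPoint t M M = (1 - t) / 2 := by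
  simp [gridPoint, hM]; ring

theorem gridPoint_succ (t : ℝ) (M k : ℕ) :
    gridPoint t M (k + 1) = gridPoint t M k + (1 - t) / M := by
  simp [gridPoint]; ring

/-- Knowing where the first set ends and where the second begins on a grid decides whether a line
is low or high. -/
theorem IsConvexCover.line_dichotomy {B : Fin 3 → Set (ℝ × ℝ)} (hB : IsConvexCover B) {t h : ℝ}
    (ht₀ : 0 ≤ t) (ht₁ : t ≤ 1) {M k l : ℕ} (hM : 1 / (M : ℝ) ≤ h / 2) (hk : k < M) (hl : l < M)
    (hk₀ : (gridPoint t M k, t) ∈ B 0)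
    (hk₁ : k + 1 = M ∨ (gridPoint t M (k + 1), t) ∉ B 0)
    (hl₀ : l = 0 ∨ (gridPoint t M l, t) ∉ B 1)
    (hl₁ : (gridPoint t M (l + 1), t) ∈ B 1) :
    if l ≤ k then IsHighLine B h t (gridPoint t M k, gridPoint t M (k + 1))
    else IsLowLine B h t (gridPoint t M (k + 1), gridPoint t M l) := by
  have hmono := gridPoint_mono ht₁ M
  have hM₀ : M ≠ 0 := by omega
  have hstep : (1 - t) / M ≤ h / 2 := by
    refine le_trans ?_ hM
    gcongr
    linarith
  have hright : ∀ {i j : ℕ}, i ≤ j → j ≤ M → (gridPoint t M i, t) ∈ B 1 →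
      (gridPoint t M j, t) ∈ B 1 := fun hij hj hi =>
    (hB.convex 1).mem_of_fst_between hi (hB.right_end_mem ht₀ ht₁) (hmono hij)
      ((hmono hj).trans_eq (gridPoint_self t hM₀))
  have hleft : ∀ {i j : ℕ}, i ≤ j → (gridPoint t M j, t) ∈ B 0 →
      (gridPoint t M i, t) ∈ B 0 := fun {i j} hij hj =>
    (hB.convex 0).mem_of_fst_between (hB.left_end_mem ht₀ ht₁) hj
      ((gridPoint_zero t M).symm.trans_le (hmono (Nat.zero_le i))) (hmono hij)
  split_ifs with hlk
  · refine ⟨hmono (Nat.le_succ k), ?_, hk₀, hright (by omega) (by omega) hl₁⟩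
    simp only [gridPoint_succ]
    linarith
  · have hk₁' := hk₁.resolve_left (by omega)
    have hl₀' := hl₀.resolve_left (by omega)
    -- Grid points in the gap belong to neither the first nor the second set.
    have hgap : ∀ j, k + 1 ≤ j → j ≤ l → (gridPoint t M j, t) ∈ B 2 := by
      intro j hkj hjl
      obtain ⟨i, hi⟩ := hB.cover _ (gridPoint_mem ht₀ ht₁ (M := M) (k := j) (by omega))
      fin_cases i
      · exact absurd (hleft hkj hi) hk₁'
      · exact absurd (hright hjl (by omega) hi) hl₀'
      · exact hi
    refine ⟨hmono (by omega), hgap _ le_rfl (by omega), hgap _ (by omega) le_rfl,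
      ⟨_, ?_, hmono (Nat.le_succ k), hk₀⟩, ⟨_, hmono (Nat.le_succ l), ?_, hl₁⟩⟩
    · simp only [gridPoint_succ]; linarith
    · simp only [gridPoint_succ]; linarith

/-! ### A common fair point for three covers by triangles -/

/-- Prices for an optimal assignment. If the diagonal maximizes the product over all permutations,
then some `x` satisfies `x a / w a a ≤ x b / w a b` for all `a` and `b`: take for `x b` the greatest
product of ratios `w a b / w a a` along a path from `0` to `b`, cleared of denominators. -/
theorem exists_prices_of_diagonal_optimal {w : Fin 3 → Fin 3 → ℝ} (hw : ∀ a b, 0 < w a b)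
    (hopt : ∀ τ : Equiv.Perm (Fin 3), ∏ a, w a (τ a) ≤ ∏ a, w a a) :
    ∃ x : Fin 3 → ℝ, (∀ b, 0 < x b) ∧ ∀ a b, x a * w a b ≤ x b * w a a := by
  have h₀₁ := hopt (Equiv.swap 0 1)
  have h₀₂ := hopt (Equiv.swap 0 2)
  have h₁₂ := hopt (Equiv.swap 1 2)
  have h₀₁₂ := hopt (finRotate 3)
  have h₀₂₁ := hopt (finRotate 3).symm
  have e₀ : (finRotate 3).symm 0 = 2 := by decide
  have e₁ : (finRotate 3).symm 1 = 0 := by decide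
  have e₂ : (finRotate 3).symm 2 = 1 := by decide
  have e₃ : Equiv.swap (0 : Fin 3) 1 2 = 2 := by decide
  have e₄ : Equiv.swap (0 : Fin 3) 2 1 = 1 := by decide
  have e₅ : Equiv.swap (1 : Fin 3) 2 0 = 0 := by decide
  have e₆ : finRotate 3 0 = 1 := by decide
  have e₇ : finRotate 3 1 = 2 := by decide
  have e₈ : finRotate 3 2 = 0 := by decide
  simp only [Fin.prod_univ_three, Equiv.swap_apply_left, Equiv.swap_apply_right, e₀, e₁, e₂, e₃, e₄,
    e₅, e₆, e₇, e₈] at h₀₁ h₀₂ h₁₂ h₀₁₂ h₀₂₁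
  have q₁₂ : w 1 2 * w 2 1 ≤ w 1 1 * w 2 2 := le_of_mul_le_mul_left (by linarith) (hw 0 0)
  have k₁ := le_max_left (w 0 1 * w 2 2) (w 0 2 * w 2 1)
  have k₂ := le_max_right (w 0 1 * w 2 2) (w 0 2 * w 2 1)
  have k₃ := le_max_left (w 0 2 * w 1 1) (w 0 1 * w 1 2)
  have k₄ := le_max_right (w 0 2 * w 1 1) (w 0 1 * w 1 2)
  have l₁ := max_cases (w 0 1 * w 2 2) (w 0 2 * w 2 1)
  have l₂ := max_cases (w 0 2 * w 1 1) (w 0 1 * w 1 2)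
  set m₁ := max (w 0 1 * w 2 2) (w 0 2 * w 2 1)
  set m₂ := max (w 0 2 * w 1 1) (w 0 1 * w 1 2)
  have p (a b) := hw a b
  have pm₁ : 0 < m₁ := (mul_pos (p 0 1) (p 2 2)).trans_le k₁
  have pm₂ : 0 < m₂ := (mul_pos (p 0 2) (p 1 1)).trans_le k₃
  have c₁₀ : m₁ * w 1 0 ≤ w 0 0 * w 1 1 * w 2 2 := by
    rcases l₁ with ⟨h, -⟩ | ⟨h, -⟩ <;> rw [h] <;> linarith
  have c₂₀ : m₂ * w 2 0 ≤ w 0 0 * w 1 1 * w 2 2 := by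
    rcases l₂ with ⟨h, -⟩ | ⟨h, -⟩ <;> rw [h] <;> linarith
  have c₁₂ : m₁ * w 1 2 ≤ w 2 2 * m₂ := by
    rcases l₁ with ⟨h, -⟩ | ⟨h, -⟩ <;> rw [h]
    · linarith [mul_le_mul_of_nonneg_left k₄ (p 2 2).le]
    · linarith [mul_le_mul_of_nonneg_left k₃ (p 2 2).le,
        mul_le_mul_of_nonneg_left q₁₂ (p 0 2).le]
  have c₂₁ : m₂ * w 2 1 ≤ w 1 1 * m₁ := by
    rcases l₂ with ⟨h, -⟩ | ⟨h, -⟩ <;> rw [h]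
    · linarith [mul_le_mul_of_nonneg_left k₂ (p 1 1).le]
    · linarith [mul_le_mul_of_nonneg_left k₁ (p 1 1).le,
        mul_le_mul_of_nonneg_left q₁₂ (p 0 1).le]
  refine ⟨![w 0 0 * w 1 1 * w 2 2, w 1 1 * m₁, w 2 2 * m₂], ?_, ?_⟩
  · have := mul_pos (mul_pos (p 0 0) (p 1 1)) (p 2 2)
    have := mul_pos (p 1 1) pm₁
    have := mul_pos (p 2 2) pm₂
    intro b
    fin_cases b <;> simpa
  · have d₀₁ := mul_le_mul_of_nonneg_left k₁ (mul_pos (p 0 0) (p 1 1)).le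
    have d₀₂ := mul_le_mul_of_nonneg_left k₃ (mul_pos (p 0 0) (p 2 2)).le
    have d₁₀ := mul_le_mul_of_nonneg_left c₁₀ (p 1 1).le
    have d₂₀ := mul_le_mul_of_nonneg_left c₂₀ (p 2 2).le
    have d₁₂ := mul_le_mul_of_nonneg_left c₁₂ (p 1 1).le
    have d₂₁ := mul_le_mul_of_nonneg_left c₂₁ (p 2 2).le
    intro a b
    fin_cases a <;> fin_cases b <;> simp <;> linarith

/-- If agent `i` prefers at `x` the rooms `j` with the least ratio `x j / p i j`, then some `x` in
the simplex and some assignment are envy-free. The inequality is cross-multiplied. -/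
theorem exists_envyFree_of_pos {p : Fin 3 → Fin 3 → ℝ} (hp : ∀ i j, 0 < p i j) :
    ∃ σ : Equiv.Perm (Fin 3), ∃ x ∈ stdSimplex ℝ (Fin 3),
      ∀ i j, x (σ i) * p i j ≤ x j * p i (σ i) := by
  obtain ⟨σ, -, hσ⟩ := Finset.exists_max_image Finset.univ
    (fun σ : Equiv.Perm (Fin 3) => ∏ i, p i (σ i)) Finset.univ_nonempty
  obtain ⟨x, hx, hxw⟩ := exists_prices_of_diagonal_optimal (w := fun a b => p (σ.symm a) b)
    (fun a b => hp _ _) fun τ => by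
      have := hσ (σ.trans τ) (Finset.mem_univ _)
      rw [← Equiv.prod_comp σ, ← Equiv.prod_comp σ (fun a => p (σ.symm a) a)]
      simpa using this
  have hsum : 0 < ∑ b, x b := Finset.sum_pos (fun b _ => hx b) Finset.univ_nonempty
  refine ⟨σ, fun b => x b / ∑ c, x c, ⟨fun b => (div_pos (hx b) hsum).le, ?_⟩, fun i j => ?_⟩
  · rw [← Finset.sum_div, div_self hsum.ne']
  · have := hxw (σ i) j
    simp only [Equiv.symm_apply_apply] at this
    rw [div_mul_eq_mul_div, div_mul_eq_mul_div]
    gcongr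

/-- The boundary case of `exists_envyFree_of_pos`, by compactness. -/
theorem exists_envyFree {p : Fin 3 → Fin 3 → ℝ} (hp : ∀ i j, 0 ≤ p i j) :
    ∃ σ : Equiv.Perm (Fin 3), ∃ x ∈ stdSimplex ℝ (Fin 3),
      ∀ i j, x (σ i) * p i j ≤ x j * p i (σ i) := by
  have hclosed : IsClosed (⋃ σ : Equiv.Perm (Fin 3), Prod.fst ''
      {q : (Fin 3 → Fin 3 → ℝ) × stdSimplex ℝ (Fin 3) |
        ∀ i j, q.2.1 (σ i) * q.1 i j ≤ q.2.1 j * q.1 i (σ i)}) := by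
    refine isClosed_iUnion_of_finite fun σ => isClosedMap_fst_of_compactSpace _ ?_
    simp only [Set.ofPred_forall]
    have hx : ∀ k, Continuous fun q : (Fin 3 → Fin 3 → ℝ) × stdSimplex ℝ (Fin 3) => q.2.1 k :=
      fun k => (continuous_apply k).comp (continuous_subtype_val.comp continuous_snd)
    refine isClosed_iInter fun i => isClosed_iInter fun j => isClosed_le ?_ ?_
    · exact (hx _).mul (by fun_prop)
    · exact (hx _).mul (by fun_prop)
  have hlim : Filter.Tendsto (fun n : ℕ => fun i j => p i j + 1 / ((n : ℝ) + 1)) Filter.atTop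
      (nhds p) := by
    refine tendsto_pi_nhds.2 fun i => tendsto_pi_nhds.2 fun j => ?_
    simpa using tendsto_const_nhds.add (tendsto_one_div_add_atTop_nhds_zero_nat (𝕜 := ℝ))
  have hmem := hclosed.mem_of_tendsto hlim (Filter.Eventually.of_forall fun n => by
    obtain ⟨σ, x, hx, h⟩ := exists_envyFree_of_pos
      (p := fun i j => p i j + 1 / ((n : ℝ) + 1)) fun i j => by have := hp i j; positivity
    exact Set.mem_iUnion.2 ⟨σ, ⟨_, ⟨x, hx⟩⟩, h, rfl⟩)
  obtain ⟨σ, ⟨_, x⟩, h, rfl⟩ := Set.mem_iUnion.1 hmem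
  exact ⟨σ, x, x.2, h⟩

/-- A point `x` lies in the simplex spanned by `p` and the facet opposite to `v j` as soon as the
ratio of the barycentric coordinates of `x` and `p` is least at `j`. -/
theorem Convex.sum_smul_mem_of_facet_subset {d : ℕ} {E : Type*} [NormedAddCommGroup E]
    [NormedSpace ℝ E] {v : Fin d → E} {C : Set E} (hC : Convex ℝ C) {j : Fin d}
    (hj : facet v j ⊆ C) {x p : Fin d → ℝ} (hx : x ∈ stdSimplex ℝ (Fin d))
    (hp : p ∈ stdSimplex ℝ (Fin d)) (hpC : ∑ k, p k • v k ∈ C)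
    (h : ∀ k, x j * p k ≤ x k * p j) : ∑ k, x k • v k ∈ C := by
  -- If `p j = 0` then `x j = 0`, and the quotient `l = 0` is the right weight of `p` as well.
  obtain ⟨l, hl₀, hlj, hl⟩ : ∃ l : ℝ, 0 ≤ l ∧ x j = l * p j ∧ ∀ k, l * p k ≤ x k := by
    rcases (hp.1 j).eq_or_lt with hpj | hpj
    · obtain ⟨k, -, hk⟩ : ∃ k ∈ Finset.univ, 0 < p k :=
        Finset.exists_lt_of_sum_lt (f := fun _ => (0 : ℝ)) (by simp [hp.2])
      have := h k
      rw [← hpj, mul_zero] at this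
      refine ⟨0, le_rfl, ?_, fun k => by simpa using hx.1 k⟩
      have := nonpos_of_mul_nonpos_left this hk
      simpa using le_antisymm this (hx.1 j)
    · refine ⟨x j / p j, div_nonneg (hx.1 j) hpj.le, by field_simp, fun k => ?_⟩
      rw [div_mul_eq_mul_div, div_le_iff₀ hpj]
      exact h k
  set z : Fin d → E := Function.update v j (∑ k, p k • v k) with hz
  have hzC : ∀ k ∈ Finset.univ, z k ∈ C := by
    intro k _
    by_cases hkj : k = j
    · subst hkj; simpa [hz] using hpC
    · rw [hz, Function.update_of_ne hkj]
      exact hj (subset_convexHull ℝ _ ⟨k, hkj, rfl⟩)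
  have key := hC.sum_mem (w := fun k => (x k - l * p k) + if k = j then l else 0)
    (fun k _ => add_nonneg (sub_nonneg.2 (hl k)) (by split_ifs <;> simp [hl₀])) (by
      simp [Finset.sum_add_distrib, ← Finset.mul_sum, hx.2, hp.2]) hzC
  have hterm : ∀ k, (x k - l * p k) • z k = (x k - l * p k) • v k := by
    intro k
    by_cases hkj : k = j
    · subst hkj; simp [hlj]
    · rw [hz, Function.update_of_ne hkj]
  simp only [add_smul, Finset.sum_add_distrib, hterm, ite_smul, zero_smul,
    Finset.sum_ite_eq', Finset.mem_univ, if_true] at key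
  simp only [hz, Function.update_self, sub_smul, Finset.sum_sub_distrib, mul_smul,
    ← Finset.smul_sum] at key
  simpa using key

theorem mem_divisionSimplex_iff {d : ℕ} {E : Type*} [NormedAddCommGroup E] [NormedSpace ℝ E]
    {v : Fin d → E} {x : E} :
    x ∈ divisionSimplex v ↔ ∃ w ∈ stdSimplex ℝ (Fin d), ∑ k, w k • v k = x := by
  have himage : divisionSimplex v = Fintype.linearCombination ℝ v '' stdSimplex ℝ (Fin d) := by
    rw [← convexHull_rangle_single_eq_stdSimplex, LinearMap.image_convexHull, ← Set.range_comp,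
      divisionSimplex]
    congr 2
    ext k
    simp
  rw [himage]
  simp [Fintype.linearCombination_apply]

/-- Points `p i` that belong to all sets of the `i`-th convex cover determine a point that is fair
for every family of such covers. -/
theorem exists_fair_of_centres {E : Type*} [NormedAddCommGroup E] [NormedSpace ℝ E]
    {v : Fin 3 → E} {p : Fin 3 → E} (hp : ∀ i, p i ∈ divisionSimplex v) :
    ∃ x ∈ divisionSimplex v, ∃ σ : Equiv.Perm (Fin 3), ∀ C : Fin 3 → Fin 3 → Set E,
      (∀ i j, Convex ℝ (C i j)) → (∀ i j, facet v j ⊆ C i j) → (∀ i j, p i ∈ C i j) →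
      ∀ i, x ∈ C i (σ i) := by
  choose w hw hwp using fun i => mem_divisionSimplex_iff.1 (hp i)
  obtain ⟨σ, x, hx, h⟩ := exists_envyFree fun i j => (hw i).1 j
  refine ⟨_, mem_divisionSimplex_iff.2 ⟨x, hx, rfl⟩, σ, fun C hC hf hpC i => ?_⟩
  exact (hC i (σ i)).sum_smul_mem_of_facet_subset (hf i _) hx (hw i) (by rw [hwp]; exact hpC i _)
    (h i)

/-! ### The algorithm -/

section Algorithm

variable {E : Type*} [NormedAddCommGroup E]

/-- The affine map that sends the vertices `(1/2, 0)`, `(-1/2, 0)`, `(0, 1)` of the model triangle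
to `v 0`, `v 1`, `v 2`. -/
noncomputable def chart [NormedSpace ℝ E] (v : Fin 3 → E) (x : ℝ × ℝ) : E :=
  ((1 - x.2) / 2 + x.1) • v 0 + ((1 - x.2) / 2 - x.1) • v 1 + x.2 • v 2

theorem chart_combination [NormedSpace ℝ E] (v : Fin 3 → E) (x y : ℝ × ℝ) {a b : ℝ}
    (hab : a + b = 1) : chart v (a • x + b • y) = a • chart v x + b • chart v y := by
  obtain rfl : b = 1 - a := by linarith
  simp only [chart, Prod.fst_add, Prod.snd_add, Prod.smul_fst, Prod.smul_snd, smul_eq_mul]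
  module

theorem chart_mem_divisionSimplex [NormedSpace ℝ E] (v : Fin 3 → E) {x : ℝ × ℝ}
    (hx : x ∈ modelTriangle) : chart v x ∈ divisionSimplex v := by
  obtain ⟨h₀, h⟩ := hx
  obtain ⟨h₁, h₂⟩ := abs_le.1 h
  refine mem_divisionSimplex_iff.2
    ⟨![(1 - x.2) / 2 + x.1, (1 - x.2) / 2 - x.1, x.2], ⟨fun k => ?_, ?_⟩, ?_⟩
  · fin_cases k <;> simp <;> linarith
  · simp [Fin.sum_univ_three]
  · simp [Fin.sum_univ_three, chart]

theorem IsUnitRegularSimplex.dist_chart_sq [InnerProductSpace ℝ E] {v : Fin 3 → E}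
    (hv : IsUnitRegularSimplex v) (x y : ℝ × ℝ) :
    dist (chart v x) (chart v y) ^ 2 = (x.1 - y.1) ^ 2 + 3 / 4 * (x.2 - y.2) ^ 2 := by
  have h₀₂ : ‖v 0 - v 2‖ = 1 := by rw [← dist_eq_norm]; exact hv _ _ (by decide)
  have h₁₂ : ‖v 1 - v 2‖ = 1 := by rw [← dist_eq_norm]; exact hv _ _ (by decide)
  have h₀₁ : ‖(v 0 - v 2) - (v 1 - v 2)‖ = 1 := by
    rw [sub_sub_sub_cancel_right, ← dist_eq_norm]; exact hv _ _ (by decide)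
  have hinner : inner ℝ (v 0 - v 2) (v 1 - v 2) = 1 / 2 := by
    have := norm_sub_sq_real (v 0 - v 2) (v 1 - v 2)
    rw [h₀₁, h₀₂, h₁₂] at this
    linarith
  have hdiff : chart v x - chart v y = ((x.1 - y.1) - (x.2 - y.2) / 2) • (v 0 - v 2) +
      (-(x.1 - y.1) - (x.2 - y.2) / 2) • (v 1 - v 2) := by
    simp only [chart]
    module
  rw [dist_eq_norm, hdiff, norm_add_sq_real, norm_smul, norm_smul, inner_smul_left,
    inner_smul_right, hinner, h₀₂, h₁₂, mul_one, mul_one, Real.norm_eq_abs, Real.norm_eq_abs,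
    sq_abs, sq_abs, conj_trivial]
  ring

/-- The hypotheses on the preference sets under which the algorithm has to be correct. -/
def IsConvexProfile [NormedSpace ℝ E] (v : Fin 3 → E) (S : Fin 3 → Fin 3 → Set E) : Prop :=
  IsPreferenceProfile v S ∧ (∀ i j, Convex ℝ (S i j)) ∧ ∀ i j, facet v j ⊆ S i j

/-- A preference set seen in the model triangle. -/
def pullback [NormedSpace ℝ E] (v : Fin 3 → E) (C : Set E) : Set (ℝ × ℝ) :=
  {x | x ∈ modelTriangle ∧ chart v x ∈ C}

theorem convex_modelTriangle : Convex ℝ modelTriangle := by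
  rintro x ⟨hx, hx'⟩ y ⟨hy, hy'⟩ a b ha hb hab
  obtain ⟨hx₁, hx₂⟩ := abs_le.1 hx'
  obtain ⟨hy₁, hy₂⟩ := abs_le.1 hy'
  obtain rfl : b = 1 - a := by linarith
  refine ⟨?_, abs_le.2 ⟨?_, ?_⟩⟩ <;>
    simp only [Prod.fst_add, Prod.snd_add, Prod.smul_fst, Prod.smul_snd, smul_eq_mul] <;> nlinarith

theorem IsConvexProfile.isConvexCover [NormedSpace ℝ E] {v : Fin 3 → E}
    {S : Fin 3 → Fin 3 → Set E} (hS : IsConvexProfile v S) (i : Fin 3) :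
    IsConvexCover fun j => pullback v (S i j) := by
  obtain ⟨hS, hconv, hfacet⟩ := hS
  have hv : ∀ j k, k ≠ j → v k ∈ S i j := fun j k hkj =>
    hfacet i j (subset_convexHull ℝ _ ⟨k, hkj, rfl⟩)
  have hleft : chart v (-1 / 2, 0) = v 1 := by simp [chart]; norm_num
  have hright : chart v (1 / 2, 0) = v 0 := by simp [chart]; norm_num
  have happex : chart v (0, 1) = v 2 := by simp [chart]
  have mleft : ((-1 / 2, 0) : ℝ × ℝ) ∈ modelTriangle := ⟨le_rfl, by norm_num [abs_le]⟩
  have mright : ((1 / 2, 0) : ℝ × ℝ) ∈ modelTriangle := ⟨le_rfl, by norm_num [abs_le]⟩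
  have mapex : ((0, 1) : ℝ × ℝ) ∈ modelTriangle := ⟨zero_le_one, by norm_num⟩
  refine ⟨fun j x hx y hy a b ha hb hab => ⟨convex_modelTriangle hx.1 hy.1 ha hb hab, ?_⟩,
    fun j x hx => hx.1, fun x hx => ?_, ⟨⟨mleft, ?_⟩, mapex, ?_⟩, ⟨⟨mright, ?_⟩, mapex, ?_⟩,
    ⟨mleft, ?_⟩, mright, ?_⟩
  · rw [chart_combination v x y hab]
    exact hconv i j hx.2 hy.2 ha hb hab
  · have := chart_mem_divisionSimplex v hx
    rw [← hS.iUnion_eq i] at this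
    obtain ⟨j, hj⟩ := Set.mem_iUnion.1 this
    exact ⟨j, hx, hj⟩
  · rw [hleft]; exact hv _ _ (by decide)
  · rw [happex]; exact hv _ _ (by decide)
  · rw [hright]; exact hv _ _ (by decide)
  · rw [happex]; exact hv _ _ (by decide)
  · rw [hleft]; exact hv _ _ (by decide)
  · rw [hright]; exact hv _ _ (by decide)

theorem learnable_mem_pullback [NormedSpace ℝ E] (v : Fin 3 → E)
    (V : (Fin 3 → Fin 3 → Set E) → Prop) (i j : Fin 3) {x : ℝ × ℝ} (hx : x ∈ modelTriangle) :
    Learnable (divisionSimplex v) V 1 fun S (b : Bool) => b = true ↔ x ∈ pullback v (S i j) :=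
  (Learnable.query i j (chart_mem_divisionSimplex v hx)).mono fun _ _ _ hb =>
    hb.trans ⟨fun h => ⟨hx, h⟩, fun h => h.2⟩

/-- Two bisections decide whether a line is low or high. -/
theorem learnable_line [NormedSpace ℝ E] (v : Fin 3 → E) (i : Fin 3) {t h : ℝ} (ht₀ : 0 ≤ t)
    (ht₁ : t ≤ 1) (s : ℕ) (hs : 1 / (2 : ℝ) ^ s ≤ h / 2) :
    Learnable (divisionSimplex v) (IsConvexProfile v) (2 * s) fun S (r : (ℝ × ℝ) ⊕ (ℝ × ℝ)) =>
      Sum.elim (IsLowLine (fun j => pullback v (S i j)) h t)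
        (IsHighLine (fun j => pullback v (S i j)) h t) r := by
  set M : ℕ := 2 ^ s with hM
  have hgrid : ∀ k, k < 0 + M → (gridPoint t M k, t) ∈ modelTriangle := fun k hk =>
    gridPoint_mem ht₀ ht₁ (by omega)
  have first := Learnable.bisection (K := divisionSimplex v) (V := IsConvexProfile v) (c := 1)
    (Lo := fun S k (_ : Unit) => (gridPoint t M k, t) ∈ pullback v (S i 0))
    (Hi := fun S k (_ : Unit) => k = M ∨ (gridPoint t M k, t) ∉ pullback v (S i 0)) s 0
    (fun k _ hk => (learnable_mem_pullback v _ i 0 (hgrid k hk)).map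
      (fun b => if b then .inl () else .inr ()) fun S _ b hb => by
        cases b
        · exact Or.inr fun h => Bool.false_ne_true (hb.2 h)
        · exact hb.1 rfl) () ()
  have second := Learnable.bisection (K := divisionSimplex v) (V := IsConvexProfile v) (c := 1)
    (Lo := fun S k (_ : Unit) => k = 0 ∨ (gridPoint t M k, t) ∉ pullback v (S i 1))
    (Hi := fun S k (_ : Unit) => (gridPoint t M k, t) ∈ pullback v (S i 1)) s 0
    (fun k _ hk => (learnable_mem_pullback v _ i 1 (hgrid k hk)).map
      (fun b => if b then .inr () else .inl ()) fun S _ b hb => by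
        cases b
        · exact Or.inr fun h => Bool.false_ne_true (hb.2 h)
        · exact hb.1 rfl) () ()
  rw [one_mul] at first second
  rw [two_mul]
  refine first.bind fun ⟨k, _, _⟩ => second.map (fun l =>
    if l.1 ≤ k then .inr (gridPoint t M k, gridPoint t M (k + 1))
    else .inl (gridPoint t M (k + 1), gridPoint t M l.1)) ?_
  rintro S hS ⟨l, _, _⟩ hl hk
  have hB := hS.isConvexCover i
  have hM₀ : M ≠ 0 := by positivity
  simp only [← hM, zero_add] at hk hl
  obtain ⟨hkM, hk₀, hk₁⟩ := hk (by rw [gridPoint_zero]; exact hB.left_end_mem ht₀ ht₁)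
    (Or.inl trivial)
  obtain ⟨hlM, hl₀, hl₁⟩ := hl (Or.inl trivial)
    (by rw [gridPoint_self t hM₀]; exact hB.right_end_mem ht₀ ht₁)
  have key := hB.line_dichotomy ht₀ ht₁ (M := M) (by rw [hM]; exact_mod_cast hs) hkM hlM hk₀ hk₁
    hl₀ hl₁
  dsimp only
  split_ifs at key ⊢ <;> exact key

/-- For each agent a point within `1 / 2 ^ L` of all three preference sets can be found by a
bisection on the height of the line, between the base and the apex. -/
theorem learnable_centre [InnerProductSpace ℝ E] {v : Fin 3 → E} (hv : IsUnitRegularSimplex v)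
    (i : Fin 3) (L : ℕ) {ε : ℝ} (hε : 1 / (2 : ℝ) ^ L ≤ ε) :
    Learnable (divisionSimplex v) (IsConvexProfile v) (2 * (L + 1) * L) fun S (p : E) =>
      p ∈ divisionSimplex v ∧ ∀ j, p ∈ Metric.cthickening ε (S i j) := by
  set h : ℝ := 1 / (2 : ℝ) ^ L with hh
  have hh₀ : 0 ≤ h := by positivity
  have hstep : 1 / (2 : ℝ) ^ (L + 1) ≤ h / 2 := by rw [hh, pow_succ]; apply le_of_eq; field_simp
  have hlast : ((2 ^ L : ℕ) : ℝ) * h = 1 := by rw [hh]; push_cast; field_simp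
  have search := Learnable.bisection (K := divisionSimplex v) (V := IsConvexProfile v)
    (Lo := fun S k => IsLowLine (fun j => pullback v (S i j)) h (k * h))
    (Hi := fun S k => IsHighLine (fun j => pullback v (S i j)) h (k * h)) L 0
    (fun k _ hk => learnable_line v i (by positivity) (by
      have : (k : ℝ) ≤ ((2 ^ L : ℕ) : ℝ) := by exact_mod_cast (by omega : k ≤ 2 ^ L)
      calc (k : ℝ) * h ≤ ((2 ^ L : ℕ) : ℝ) * h := by gcongr
        _ = 1 := hlast) (L + 1) hstep) (-1 / 2, 1 / 2) (0, 0)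
  refine search.map (fun r => chart v (nearCentre h (r.1 * h) r.2.1 r.2.2)) ?_
  rintro S hS ⟨k, r, q⟩ hr
  have hB := hS.isConvexCover i
  obtain ⟨-, hlow, hhigh⟩ := hr (by simpa using hB.isLowLine_zero hh₀)
    (by rw [zero_add, hlast]; exact hB.isHighLine_one hh₀)
  simp only [Nat.cast_add, Nat.cast_one, add_mul, one_mul] at hlow hhigh
  obtain ⟨hmem, hnear⟩ := hB.nearCentre_spec hh₀ hlow hhigh
  refine ⟨chart_mem_divisionSimplex v hmem, fun j => ?_⟩
  obtain ⟨y, hy, hdist⟩ := hnear j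
  refine Metric.mem_cthickening_of_dist_le _ (chart v y) _ _ hy.2 (le_trans ?_ hε)
  rw [← hv.dist_chart_sq] at hdist
  exact (sq_le_sq₀ dist_nonneg hh₀).1 hdist

/-- Once an approximate centre is known for every agent, no further query is needed. -/
theorem learnable_fairDivisionPoint [InnerProductSpace ℝ E] {v : Fin 3 → E}
    (hv : IsUnitRegularSimplex v) (L : ℕ) {ε : ℝ} (hε : 1 / (2 : ℝ) ^ L ≤ ε) :
    Learnable (divisionSimplex v) (IsConvexProfile v) (6 * (L ^ 2 + L))
      fun S (x : divisionSimplex v) => IsFairDivisionPoint v S ε x := by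
  have centre := fun i => learnable_centre hv i L hε
  have hcost : 6 * (L ^ 2 + L) = 2 * (L + 1) * L + (2 * (L + 1) * L + (2 * (L + 1) * L + 0)) := by
    ring
  rw [hcost]
  refine (centre 0).bind fun p₀ => (centre 1).bind fun p₁ => (centre 2).bind fun p₂ => ?_
  by_cases hp : ∀ i, ![p₀, p₁, p₂] i ∈ divisionSimplex v
  · obtain ⟨x, hx, σ, hσ⟩ := exists_fair_of_centres hp
    refine .pure ⟨x, hx⟩ fun S hS h₂ h₁ h₀ => ⟨hx, σ, ?_⟩
    refine hσ (fun i j => Metric.cthickening ε (S i j)) (fun i j => (hS.2.1 i j).cthickening ε)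
      (fun i j => (hS.2.2 i j).trans (Metric.self_subset_cthickening _)) fun i j => ?_
    fin_cases i
    · exact h₀.2 j
    · exact h₁.2 j
    · exact h₂.2 j
  -- Otherwise the promise is broken, and any output will do.
  · refine .pure ⟨v 0, subset_convexHull ℝ _ ⟨0, rfl⟩⟩ fun S hS h₂ h₁ h₀ => absurd ?_ hp
    intro i
    fin_cases i
    · exact h₀.1
    · exact h₁.1
    · exact h₂.1

end Algorithm

/-! ### The number of queries -/

theorem one_div_two_pow_ceil_logb_le {ε : ℝ} (hε : 0 < ε) {n : ℕ} (hn : n = ⌈1 / ε⌉₊) :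
    1 / (2 : ℝ) ^ ⌈Real.logb 2 n⌉₊ ≤ ε := by
  have hle : 1 / ε ≤ n := hn ▸ Nat.le_ceil _
  have hn₀ : (0 : ℝ) < n := (by positivity : 0 < 1 / ε).trans_le hle
  have hpow : (n : ℝ) ≤ 2 ^ ⌈Real.logb 2 n⌉₊ := by
    rw [← Real.rpow_natCast, ← Real.logb_le_iff_le_rpow (by norm_num) hn₀]
    exact Nat.le_ceil _
  rw [one_div_le (by positivity) hε]
  exact hle.trans hpow

theorem isBigO_ceil_logb_sq :
    (fun n : ℕ => ((6 * (⌈Real.logb 2 (n : ℝ)⌉₊ ^ 2 + ⌈Real.logb 2 (n : ℝ)⌉₊) : ℕ) : ℝ))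
      =O[Filter.atTop] (fun n : ℕ => (Real.log (n : ℝ)) ^ 2) := by
  refine Asymptotics.IsBigO.of_bound 72 ?_
  filter_upwards [Filter.eventually_ge_atTop 3] with n hn
  have hn₀ : (0 : ℝ) < n := by positivity
  have hlog : 1 ≤ Real.log n := by
    rw [Real.le_log_iff_exp_le hn₀]
    have : (3 : ℝ) ≤ n := by exact_mod_cast hn
    linarith [Real.exp_one_lt_d9]
  have hlogb : Real.logb 2 n ≤ 2 * Real.log n := by
    rw [Real.logb, div_le_iff₀ (Real.log_pos one_lt_two)]
    nlinarith [Real.log_two_gt_d9]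
  have hlogb₀ : 0 ≤ Real.logb 2 n :=
    Real.logb_nonneg one_lt_two (by exact_mod_cast (by omega : 1 ≤ n))
  have hceil := Nat.ceil_lt_add_one hlogb₀
  set c : ℕ := ⌈Real.logb 2 n⌉₊
  have hc : (c : ℝ) ≤ 3 * Real.log n := by linarith
  rw [Real.norm_of_nonneg (by positivity), Real.norm_of_nonneg (by positivity)]
  push_cast
  nlinarith [(Nat.cast_nonneg c : (0 : ℝ) ≤ c)]

theorem mainTheorem3 :
    (∀ v : Fin 3 → EuclideanSpace ℝ (Fin 2), IsUnitRegularSimplex v →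
      ∀ ε : ℝ, 0 < ε → ∀ n : ℕ, n = ⌈1 / ε⌉₊ →
        ∃ alg : BinaryAlgorithm 3 (divisionSimplex v),
          alg.maxQueries ≤ 6 * (⌈Real.logb 2 (n : ℝ)⌉₊ ^ 2 + ⌈Real.logb 2 (n : ℝ)⌉₊) ∧
          ∀ S : Fin 3 → Fin 3 → Set (EuclideanSpace ℝ (Fin 2)),
            IsPreferenceProfile v S →
            (∀ i j, Convex ℝ (S i j)) →
            (∀ i j, facet v j ⊆ S i j) →
            IsFairDivisionPoint v S ε (alg.run S : EuclideanSpace ℝ (Fin 2))) ∧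
    (fun n : ℕ => ((6 * (⌈Real.logb 2 (n : ℝ)⌉₊ ^ 2 + ⌈Real.logb 2 (n : ℝ)⌉₊) : ℕ) : ℝ))
      =O[Filter.atTop] (fun n : ℕ => (Real.log (n : ℝ)) ^ 2) := by
  refine ⟨fun v hv ε hε n hn => ?_, isBigO_ceil_logb_sq⟩
  obtain ⟨T, hT, hfair⟩ :=
    learnable_fairDivisionPoint hv _ (one_div_two_pow_ceil_logb_le hε hn)
  refine ⟨T.toBinaryAlgorithm id, ?_, fun S hS hconv hfacet => ?_⟩
  · rwa [QueryTree.maxQueries_toBinaryAlgorithm]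
  · rw [QueryTree.run_toBinaryAlgorithm]
    exact hfair S ⟨hS, hconv, hfacet⟩
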